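/- A poset $(P,\le_P)$ with $P\subseteq\omega$ infinite is \emph{stable} if either every $x\in P$ is small ($x\le_P y$ for all but finitely many $y\in P$) or isolated ($x$ is $\le_P$-incomparable with all but finitely many $y\in P$), or every $x\in P$ is large ($y\le_P x$ for all but finitely many $y\in P$) or isolated. It is \emph{$\omega$-ordered} if $x\le_P y$ implies $x\le y$ for all $x,y\in P$. Let $\mathsf{SCAC}$ be the problem whose instances are the infinite stable posets $(P,\le_P)$ with $P\subseteq\omega$, coded as subsets of $\omega$, and whose solutions to $(P,\le_P)$ are the infinite chains and the infinite antichains of $(P,\le_P)$. Let $\omega\text{-}\mathsf{SCAC}$ be the restriction of $\mathsf{SCAC}$ to $\omega$-ordered instances. A problem $\mathsf{P}$ is \emph{Weihrauch reducible} to a problem $\mathsf{Q}$, written $\mathsf{P}\le_{\mathrm W}\mathsf{Q}$, if there are Turing functionals $\Phi$ and $\Psi$ such that for every instance $X$ of $\mathsf{P}$ the set defined by $\Phi^{X}$ is an instance of $\mathsf{Q}$, and for every solution $Y$ of that instance, $\Psi^{X\oplus Y}$ defines a solution to $X$. \textbf{Corollary.} $\mathsf{SCAC}\not\le_{\mathrm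 W}\omega\text{-}\mathsf{SCAC}$. -/

import Mathlib

/-! ### Turing functionals -/

/-- Programs for oracle Turing functionals: Kleene's schemata for the partial recursive functions
together with a query instruction for the oracle. -/
inductive OracleCode : Type
  | zero : OracleCode
  | succ : OracleCode
  | left : OracleCode
  | right : OracleCode
  | oracle : OracleCode
  | pair : OracleCode → OracleCode → OracleCode
  | comp : OracleCode → OracleCode → OracleCode
  | prec : OracleCode → OracleCode → OracleCode
  | rfind : OracleCode → OracleCode

/-- The characteristic function of a set of natural numbers. -/
noncomputable def charFun (A : Set ℕ) (n : ℕ) : ℕ :=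
  A.indicator (fun _ => 1) n

/-- The partial function `Φ^A` computed by the program `Φ` with oracle (the characteristic
function of) `A`. The clauses are those of `Nat.RecursiveIn`, but the program does not depend on
the oracle. -/
noncomputable def OracleCode.eval (A : Set ℕ) : OracleCode → (ℕ →. ℕ)
  | .zero => fun _ => Part.some 0
  | .succ => fun n => Part.some (n + 1)
  | .left => fun n => Part.some n.unpair.1
  | .right => fun n => Part.some n.unpair.2
  | .oracle => fun n => Part.some (charFun A n)
  | .pair cf cg => fun n => Nat.pair <$> eval A cf n <*> eval A cg n
  | .comp cf cg => fun n => eval A cg n >>= eval A cf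
  | .prec cf cg => fun p =>
      let (a, n) := Nat.unpair p
      n.rec (eval A cf a) fun y IH => do
        let i ← IH
        eval A cg (Nat.pair a (Nat.pair y i))
  | .rfind cf => fun a =>
      Nat.rfind fun n => (fun m => decide (m = 0)) <$> eval A cf (Nat.pair a n)

/-- `Φ^A` is total and is the characteristic function of the set `B`. -/
def OracleCode.Defines (Φ : OracleCode) (A B : Set ℕ) : Prop :=
  ∀ n, Φ.eval A n = Part.some (charFun B n)

/-- The join `A ⊕ B = {2n : n ∈ A} ∪ {2n + 1 : n ∈ B}`. -/
def setJoin (A B : Set ℕ) : Set ℕ :=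
  (fun n => 2 * n) '' A ∪ (fun n => 2 * n + 1) '' B

/-! ### Problems and Weihrauch reducibility -/

/-- An instance-solution problem on subsets of `ω`: a set of instances, and for every instance a
set of solutions (`IsSolution X Y`: `Y` is a solution to `X`, of interest for instances `X`). -/
structure ISProblem where
  IsInstance : Set ℕ → Prop
  IsSolution : Set ℕ → Set ℕ → Prop

/-- Weihrauch reducibility: fixed functionals `Φ` and `Ψ` such that for every `P`-instance `X`,
`Φ^X` defines a `Q`-instance `Z`, and for every solution `Y` of `Z`, `Ψ^(X ⊕ Y)` defines a solution
of `X`. -/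
def WeihrauchReducible (P Q : ISProblem) : Prop :=
  ∃ Φ Ψ : OracleCode, ∀ X, P.IsInstance X →
    ∃ Z, Φ.Defines X Z ∧ Q.IsInstance Z ∧
      ∀ Y, Q.IsSolution Z Y → ∃ W, Ψ.Defines (setJoin X Y) W ∧ P.IsSolution X W

/-! ### Posets on sets of natural numbers -/

/-- `(P, r)` is an infinite poset with `P ⊆ ω` and `r ⊆ P × P`. -/
structure IsInfinitePoset (P : Set ℕ) (r : ℕ → ℕ → Prop) : Prop where
  infinite : P.Infinite
  mem_of_rel : ∀ x y, r x y → x ∈ P ∧ y ∈ P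
  refl : ∀ x ∈ P, r x x
  antisymm : ∀ x y, r x y → r y x → x = y
  trans : ∀ x y z, r x y → r y z → r x z

/-- `x ≤_P y` for all but finitely many `y ∈ P`. -/
def IsSmallElt (P : Set ℕ) (r : ℕ → ℕ → Prop) (x : ℕ) : Prop :=
  {y ∈ P | ¬ r x y}.Finite

/-- `y ≤_P x` for all but finitely many `y ∈ P`. -/
def IsLargeElt (P : Set ℕ) (r : ℕ → ℕ → Prop) (x : ℕ) : Prop :=
  {y ∈ P | ¬ r y x}.Finite

/-- `x` is incomparable with `y` for all but finitely many `y ∈ P`. -/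
def IsIsolatedElt (P : Set ℕ) (r : ℕ → ℕ → Prop) (x : ℕ) : Prop :=
  {y ∈ P | r x y ∨ r y x}.Finite

/-- Every element is small or isolated, or every element is large or isolated. -/
def IsStableOrder (P : Set ℕ) (r : ℕ → ℕ → Prop) : Prop :=
  (∀ x ∈ P, IsSmallElt P r x ∨ IsIsolatedElt P r x) ∨
    (∀ x ∈ P, IsLargeElt P r x ∨ IsIsolatedElt P r x)

/-- The order respects the natural order of `ω`. -/
def IsOmegaOrdered (r : ℕ → ℕ → Prop) : Prop :=
  ∀ x y, r x y → x ≤ y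

/-- A pair `(P, ≤_P)` is coded by the set `P ⊕ {⟨x, y⟩ : x ≤_P y}`, so every set `X` codes exactly
one pair. This is the set `P` of the pair coded by `X`. -/
def codedSet (X : Set ℕ) : Set ℕ :=
  {x | 2 * x ∈ X}

/-- The relation `≤_P` of the pair `(P, ≤_P)` coded by `X`. -/
def codedRel (X : Set ℕ) (x y : ℕ) : Prop :=
  2 * Nat.pair x y + 1 ∈ X

/-- `CAC`: instances are infinite posets `(P, ≤_P)` with `P ⊆ ω`, solutions are the infinite chains
and the infinite antichains of `(P, ≤_P)`. -/
def CAC : ISProblem where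
  IsInstance X := IsInfinitePoset (codedSet X) (codedRel X)
  IsSolution X Y := Y.Infinite ∧ Y ⊆ codedSet X ∧
    (IsChain (codedRel X) Y ∨ IsAntichain (codedRel X) Y)

/-- `SCAC`: the restriction of `CAC` to stable posets. -/
def SCAC : ISProblem where
  IsInstance X := CAC.IsInstance X ∧ IsStableOrder (codedSet X) (codedRel X)
  IsSolution := CAC.IsSolution

/-- `ω-SCAC`: the restriction of `CAC` to `ω`-ordered stable posets. -/
def omegaSCAC : ISProblem where
  IsInstance X := CAC.IsInstance X ∧ IsOmegaOrdered (codedRel X) ∧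
    IsStableOrder (codedSet X) (codedRel X)
  IsSolution := CAC.IsSolution

/-!
The proof plays the undecided type of a stable poset against the `ω`-order of its image. All
posets considered have underlying set `ℕ`, and only the continuity of Turing functionals is used
(`OracleCode.eventually_mem_eval`, `Reduction`); write `Q(r)` for the `ω`-ordered poset assigned
to the order `r`. In `Q(r)` every element is small or isolated, so a finite chain of small elements
extends to a solution as soon as there are infinitely many small elements, and likewise for finite
antichains of isolated elements (`exists_isSolution_extending`). Conversely, a solution of `r` that
contains `x ≠ y` is a chain or an antichain according as `x` and `y` are comparable or not, so both
are then non-isolated or isolated accordingly (`Reduction.limitColor`).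

*Genericity.* Force with finite partial orders together with a promise for each element to be small
or isolated. For generic `r`, the poset `Q(r)` has infinitely many small and infinitely many
isolated elements (`Reduction.exists_infinite_limitColor`). Indeed, if below some condition almost
all elements of `Q(r)` were, say, isolated, then every finite antichain of them would be extendible;
take one that produces elements `x ≠ y` outside the condition, and promise `x` the limit behaviour
that contradicts the comparability status of `x` and `y`. Dualizing the order gives the same for
orders all of whose elements are large or isolated.

*The contradiction.* Fix a generic `r`. A finite chain `F` of small elements of `Q(r)` produces a
pair `x ≠ y`, and a finite antichain `E` of `Q(r)` lying above `F` produces a pair `a ≠ b`. All of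
this depends on a finite part of `r` only. Now forget the promises made by `r`: beyond this finite
part the order can still be continued so that an element of each pair has the wrong limit
behaviour. This may need elements to be large rather than small: if `x < y ≤ a` and `a`, `b` are
incomparable, then making `a` small would make `x` and `y` small, which is right for a chain, but
`a` can be made large and `x` isolated (`exists_spoiling_set`). For a generic such continuation `r'`
neither `F` nor `E` extends to a solution of `Q(r')`, so some `k ∈ F` is isolated and some `l ∈ E`
is small in `Q(r')`. But `k` is below `l`, so `k` is small as well.
-/

open Filter

/-! ### The use of an oracle computation -/

/-- The use principle: a convergent computation consults only a finite part of its oracle. -/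
theorem OracleCode.eventually_mem_eval (Φ : OracleCode) (A : Set ℕ) :
    ∀ n v, v ∈ Φ.eval A n →
      ∀ᶠ u in atTop, ∀ A' : Set ℕ, (∀ k < u, (k ∈ A' ↔ k ∈ A)) → v ∈ Φ.eval A' n := by
  induction Φ with
  | zero => exact fun n v h => .of_forall fun _ _ _ => h
  | succ => exact fun n v h => .of_forall fun _ _ _ => h
  | left => exact fun n v h => .of_forall fun _ _ _ => h
  | right => exact fun n v h => .of_forall fun _ _ _ => h
  | oracle =>
    intro n v h
    filter_upwards [eventually_gt_atTop n] with u hu A' hA'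
    have hc : charFun A' n = charFun A n := by
      classical simp only [charFun, Set.indicator_apply, hA' n hu]
    simpa [OracleCode.eval, hc] using h
  | pair cf cg hf hg =>
    intro n v h
    simp only [OracleCode.eval, Seq.seq, Part.mem_bind_iff, Part.map_eq_map,
      Part.mem_map_iff] at h ⊢
    obtain ⟨_, ⟨a, ha, rfl⟩, b, hb, rfl⟩ := h
    filter_upwards [hf n a ha, hg n b hb] with u h1 h2 A' hA'
    exact ⟨_, ⟨a, h1 A' hA', rfl⟩, b, h2 A' hA', rfl⟩
  | comp cf cg hf hg =>
    intro n v h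
    obtain ⟨a, ha, hv⟩ := Part.mem_bind_iff.1 h
    filter_upwards [hg n a ha, hf a v hv] with u h1 h2 A' hA'
    exact Part.mem_bind_iff.2 ⟨a, h1 A' hA', h2 A' hA'⟩
  | prec cf cg hf hg =>
    intro p
    simp only [OracleCode.eval]
    generalize p.unpair.1 = a
    induction p.unpair.2 with
    | zero => exact fun v h => hf a v h
    | succ y ih =>
      intro v h
      simp only [Part.bind_eq_bind, Part.mem_bind_iff] at h ⊢
      obtain ⟨i, hi, hv⟩ := h
      filter_upwards [ih i hi, hg _ v hv] with u h1 h2 A' hA'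
      exact ⟨i, h1 A' hA', h2 A' hA'⟩
  | rfind cf hf =>
    intro a v h
    obtain ⟨hv, hlt⟩ := Nat.mem_rfind.1 h
    obtain ⟨w, hw, hw0⟩ := (Part.mem_map_iff _).1 hv
    have hlt' : ∀ᶠ u in atTop, ∀ m ∈ Finset.range v, ∀ A' : Set ℕ,
        (∀ k < u, (k ∈ A' ↔ k ∈ A)) →
          ∃ w ∈ cf.eval A' (Nat.pair a m), decide (w = 0) = false := by
      rw [eventually_all_finset]
      intro m hm
      obtain ⟨w, hw, hw0⟩ := (Part.mem_map_iff _).1 (hlt (Finset.mem_range.1 hm))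
      filter_upwards [hf _ w hw] with u h1 A' hA'
      exact ⟨w, h1 A' hA', hw0⟩
    filter_upwards [hf _ w hw, hlt'] with u h1 h2 A' hA'
    exact Nat.mem_rfind.2 ⟨(Part.mem_map_iff _).2 ⟨w, h1 A' hA', hw0⟩,
      fun {m} hm => (Part.mem_map_iff _).2 (h2 m (Finset.mem_range.2 hm) A' hA')⟩

/-! ### Stable colourings of comparability -/

/-- The relation of being comparable in `r`. -/
def Comparable (r : ℕ → ℕ → Prop) (x y : ℕ) : Prop :=
  r x y ∨ r y x

theorem comparable_comm {r : ℕ → ℕ → Prop} {x y : ℕ} : Comparable r x y ↔ Comparable r y x :=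
  or_comm

theorem comparable_swap {r : ℕ → ℕ → Prop} {x y : ℕ} :
    Comparable (Function.swap r) x y ↔ Comparable r x y :=
  or_comm

/-- The comparability status of `x` with almost all elements of `P` is `c`: for `c = True`, `x` is
comparable with almost all elements of `P`, and for `c = False` it is isolated in `P`. -/
def LimitColor (P : Set ℕ) (r : ℕ → ℕ → Prop) (c : Prop) (x : ℕ) : Prop :=
  ∀ᶠ y in atTop, y ∈ P → (Comparable r x y ↔ c)

theorem LimitColor.iff {P : Set ℕ} (hP : P.Infinite) {r : ℕ → ℕ → Prop} {c d : Prop} {x : ℕ}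
    (hc : LimitColor P r c x) (hd : LimitColor P r d x) : c ↔ d := by
  obtain ⟨y, hy, h1, h2⟩ :=
    ((Nat.frequently_atTop_iff_infinite.2 hP).and_eventually (hc.and hd)).exists
  exact (h1 hy).symm.trans (h2 hy)

theorem Set.Finite.eventually_notMem_nat {S : Set ℕ} (hS : S.Finite) : ∀ᶠ y in atTop, y ∉ S := by
  rw [← Nat.cofinite_eq_atTop]; exact hS.compl_mem_cofinite

/-- In an `ω`-ordered stable poset every element is comparable with almost all elements or isolated,
whichever of the two kinds of stability holds. -/
theorem limitColor_of_isInstance {Z : Set ℕ} (hZ : omegaSCAC.IsInstance Z) {x : ℕ}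
    (hx : x ∈ codedSet Z) (c : Prop) :
    LimitColor (codedSet Z) (codedRel Z) c x ∨ LimitColor (codedSet Z) (codedRel Z) (¬ c) x := by
  obtain ⟨hP, hω, hs⟩ := hZ
  have hiso : IsIsolatedElt (codedSet Z) (codedRel Z) x →
      LimitColor (codedSet Z) (codedRel Z) False x := fun h => by
    filter_upwards [h.eventually_notMem_nat] with y hy hyP
    exact iff_of_false (fun hc => hy ⟨hyP, hc⟩) id
  have key : LimitColor (codedSet Z) (codedRel Z) True x ∨
      LimitColor (codedSet Z) (codedRel Z) False x := by
    rcases hs with hs | hs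
    · refine (hs x hx).imp (fun h => ?_) hiso
      filter_upwards [h.eventually_notMem_nat] with y hy hyP
      exact iff_of_true (Or.inl (by_contra fun hc => hy ⟨hyP, hc⟩)) trivial
    · refine .inr ((hs x hx).elim (fun h => ?_) hiso)
      -- An `ω`-ordered infinite poset has no large elements.
      obtain ⟨y, hyP, hy, hxy⟩ := ((Nat.frequently_atTop_iff_infinite.2 hP.infinite).and_eventually
        (h.eventually_notMem_nat.and (eventually_gt_atTop x))).exists
      exact absurd (hω y x (by_contra fun hc => hy ⟨hyP, hc⟩)) (not_le.2 hxy)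
  by_cases hc : c <;> simpa [hc, or_comm] using key

/-- In an `ω`-ordered poset an element below a small element is small. -/
theorem limitColor_true_of_comparable {Z : Set ℕ} (hZ : omegaSCAC.IsInstance Z) {x y : ℕ}
    (hxy : x < y) (h : Comparable (codedRel Z) x y)
    (hy : LimitColor (codedSet Z) (codedRel Z) True y) :
    LimitColor (codedSet Z) (codedRel Z) True x := by
  obtain ⟨hP, hω, -⟩ := hZ
  have hxy' : codedRel Z x y := h.resolve_right fun h => absurd (hω _ _ h) (not_le.2 hxy)
  filter_upwards [hy, eventually_gt_atTop y] with z hz hyz hzP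
  have : codedRel Z y z :=
    ((hz hzP).2 trivial).resolve_right fun h => absurd (hω _ _ h) (not_le.2 hyz)
  exact iff_of_true (.inl (hP.trans _ _ _ hxy' this)) trivial

/-- A finite homogeneous set whose elements have the matching limit colour can be continued to a
solution, and the new elements can be taken above any given bound. -/
theorem exists_isSolution_extending {Z : Set ℕ} {c : Prop}
    (hinf : {x ∈ codedSet Z | LimitColor (codedSet Z) (codedRel Z) c x}.Infinite)
    {F : Set ℕ} {u : ℕ} (hFu : ∀ x ∈ F, x < u) (hF : F ⊆ codedSet Z)
    (hFc : F.Pairwise fun x y => Comparable (codedRel Z) x y ↔ c)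
    (hFl : ∀ x ∈ F, LimitColor (codedSet Z) (codedRel Z) c x) :
    ∃ Y, omegaSCAC.IsSolution Z Y ∧ (∀ k < u, (k ∈ Y ↔ k ∈ F)) ∧
      (Y.Pairwise fun x y => Comparable (codedRel Z) x y ↔ c) ∧
      ∀ x ∈ Y, LimitColor (codedSet Z) (codedRel Z) c x := by
  have hFfin : F.Finite := (Set.finite_lt_nat u).subset hFu
  obtain ⟨f, hf, hfr⟩ := exists_seq_of_forall_finset_exists
    (fun y => u ≤ y ∧ y ∈ codedSet Z ∧ LimitColor (codedSet Z) (codedRel Z) c y ∧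
      ∀ x ∈ F, (Comparable (codedRel Z) x y ↔ c))
    (fun x y => x < y ∧ (Comparable (codedRel Z) x y ↔ c)) (by
      intro s hs
      have h1 : ∀ᶠ y in atTop, ∀ x ∈ s, x < y ∧ (y ∈ codedSet Z →
          (Comparable (codedRel Z) x y ↔ c)) :=
        (eventually_all_finset s).2 fun x hx => (eventually_gt_atTop x).and (hs x hx).2.2.1
      have h2 : ∀ᶠ y in atTop, ∀ x ∈ F, y ∈ codedSet Z → (Comparable (codedRel Z) x y ↔ c) :=
        (eventually_all_finite hFfin).2 hFl
      obtain ⟨y, ⟨hyP, hyl⟩, h1, h2, hu⟩ :=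
        ((Nat.frequently_atTop_iff_infinite.2 hinf).and_eventually (h1.and
          (h2.and (eventually_ge_atTop u)))).exists
      exact ⟨y, ⟨hu, hyP, hyl, fun x hx => h2 x hx hyP⟩, fun x hx => ⟨(h1 x hx).1, (h1 x hx).2 hyP⟩⟩)
  have hmono : StrictMono f := fun m n h => (hfr m n h).1
  have hsub : F ∪ Set.range f ⊆ codedSet Z :=
    Set.union_subset hF (Set.range_subset_iff.2 fun n => (hf n).2.1)
  have hpair : (F ∪ Set.range f).Pairwise fun x y => Comparable (codedRel Z) x y ↔ c := by
    rintro x (hx | ⟨m, rfl⟩) y (hy | ⟨n, rfl⟩) hxy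
    · exact hFc hx hy hxy
    · exact (hf n).2.2.2 x hx
    · rw [comparable_comm]; exact (hf m).2.2.2 y hy
    · rcases lt_or_gt_of_ne (fun h => hxy (congrArg f h) : m ≠ n) with h | h
      · exact (hfr m n h).2
      · rw [comparable_comm]; exact (hfr n m h).2
  refine ⟨F ∪ Set.range f, ⟨(Set.infinite_range_of_injective hmono.injective).mono
    Set.subset_union_right, hsub, ?_⟩, fun k hk => ⟨?_, .inl⟩, hpair, ?_⟩
  · by_cases hc : c
    · exact .inl fun x hx y hy hxy => (hpair hx hy hxy).2 hc
    · exact .inr fun x hx y hy hxy h => hc ((hpair hx hy hxy).1 (.inl h))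
  · rintro (h | ⟨n, rfl⟩)
    · exact h
    · exact absurd hk (not_lt.2 (hf n).1)
  · rintro x (hx | ⟨n, rfl⟩)
    · exact hFl x hx
    · exact (hf n).2.2.1

/-! ### Stable orders on the natural numbers -/

/-- A partial order on `ℕ` all of whose elements are small or isolated. -/
structure SmallStable (r : ℕ → ℕ → Prop) : Prop where
  isPartialOrder : IsPartialOrder ℕ r
  limit : ∀ x, (∀ᶠ y in atTop, r x y) ∨ ∀ᶠ y in atTop, ¬ Comparable r x y

/-- A stable partial order on `ℕ`: it or its dual has only small and isolated elements. -/
def StableRel (r : ℕ → ℕ → Prop) : Prop :=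
  SmallStable r ∨ SmallStable (Function.swap r)

theorem StableRel.swap {r : ℕ → ℕ → Prop} (h : StableRel r) : StableRel (Function.swap r) :=
  Or.symm h

theorem StableRel.isPartialOrder {r : ℕ → ℕ → Prop} (h : StableRel r) : IsPartialOrder ℕ r := by
  rcases h with h | h
  · exact h.isPartialOrder
  · have := h.isPartialOrder
    exact inferInstanceAs (IsPartialOrder ℕ (Function.swap (Function.swap r)))

theorem SmallStable.limitColor {r : ℕ → ℕ → Prop} (h : SmallStable r) (x : ℕ) (c : Prop) :
    LimitColor Set.univ r c x ∨ LimitColor Set.univ r (¬ c) x := by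
  have key : LimitColor Set.univ r True x ∨ LimitColor Set.univ r False x := by
    refine (h.limit x).imp (fun h => ?_) (fun h => ?_)
    · filter_upwards [h] with y hy _ using iff_of_true (.inl hy) trivial
    · filter_upwards [h] with y hy _ using iff_of_false hy id
  by_cases hc : c <;> simpa [hc, or_comm] using key

theorem limitColor_swap {P : Set ℕ} {r : ℕ → ℕ → Prop} {c : Prop} {x : ℕ} :
    LimitColor P (Function.swap r) c x ↔ LimitColor P r c x := by
  simp only [LimitColor, comparable_swap]

theorem StableRel.limitColor {r : ℕ → ℕ → Prop} (h : StableRel r) (x : ℕ) (c : Prop) :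
    LimitColor Set.univ r c x ∨ LimitColor Set.univ r (¬ c) x := by
  rcases h with h | h
  · exact h.limitColor x c
  · simpa only [limitColor_swap] using h.limitColor x c

/-- The code of the poset `(ℕ, r)`: all even numbers, and `2 * Nat.pair x y + 1` for `r x y`. -/
def relCode (r : ℕ → ℕ → Prop) : Set ℕ :=
  {k | k % 2 = 0 ∨ r (k / 2).unpair.1 (k / 2).unpair.2}

theorem codedSet_relCode (r : ℕ → ℕ → Prop) : codedSet (relCode r) = Set.univ := by
  ext x; simp [codedSet, relCode]

theorem codedRel_relCode (r : ℕ → ℕ → Prop) : codedRel (relCode r) = r := by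
  ext x y
  have : (2 * Nat.pair x y + 1) / 2 = Nat.pair x y := by omega
  simp [codedRel, relCode, this]

theorem SmallStable.isStableOrder {r : ℕ → ℕ → Prop} (h : SmallStable r) (x : ℕ) :
    IsSmallElt Set.univ r x ∨ IsIsolatedElt Set.univ r x := by
  refine (h.limit x).imp (fun h => ?_) (fun h => ?_)
  · rw [← Nat.cofinite_eq_atTop] at h
    simpa [IsSmallElt] using Filter.eventually_cofinite.1 h
  · rw [← Nat.cofinite_eq_atTop] at h
    simpa only [IsIsolatedElt, Set.mem_univ, true_and, not_not, Comparable] using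
      Filter.eventually_cofinite.1 h

theorem StableRel.isInstance {r : ℕ → ℕ → Prop} (h : StableRel r) :
    SCAC.IsInstance (relCode r) := by
  have hr := h.isPartialOrder
  refine ⟨?_, ?_⟩
  · change IsInfinitePoset _ _
    rw [codedSet_relCode, codedRel_relCode]
    exact ⟨Set.infinite_univ, fun _ _ _ => ⟨trivial, trivial⟩, fun x _ => hr.refl x,
      hr.antisymm, hr.trans⟩
  · rw [codedSet_relCode, codedRel_relCode]
    refine h.imp (fun h x _ => h.isStableOrder x) (fun h x _ => (h.isStableOrder x).imp id ?_)
    intro hx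
    simpa only [IsIsolatedElt, Function.swap, or_comm] using hx

theorem charFun_eq_one {S : Set ℕ} {k : ℕ} : charFun S k = 1 ↔ k ∈ S := by
  classical simp [charFun, Set.indicator_apply]

/-- The set of numbers on which `Φ^S` takes the value `1`; it is the set defined by `Φ^S`, if
there is one. -/
def OracleCode.output (Φ : OracleCode) (S : Set ℕ) : Set ℕ :=
  {k | 1 ∈ Φ.eval S k}

theorem OracleCode.Defines.eq_output {Φ : OracleCode} {S T : Set ℕ} (h : Φ.Defines S T) :
    T = Φ.output S := by
  ext k
  change _ ↔ 1 ∈ Φ.eval S k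
  rw [h k, Part.mem_some_iff, eq_comm, charFun_eq_one]

/-- `r` and `r'` agree on the natural numbers below `u`. -/
def AgreeBelow (u : ℕ) (r r' : ℕ → ℕ → Prop) : Prop :=
  ∀ x < u, ∀ y < u, (r' x y ↔ r x y)

theorem AgreeBelow.mono {u v : ℕ} {r r' : ℕ → ℕ → Prop} (h : AgreeBelow v r r') (huv : u ≤ v) :
    AgreeBelow u r r' :=
  fun x hx y hy => h x (hx.trans_le huv) y (hy.trans_le huv)

theorem AgreeBelow.swap {u : ℕ} {r r' : ℕ → ℕ → Prop} (h : AgreeBelow u r r') :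
    AgreeBelow u (Function.swap r) (Function.swap r') :=
  fun x hx y hy => h y hy x hx

theorem AgreeBelow.comparable {u : ℕ} {r r' : ℕ → ℕ → Prop} (h : AgreeBelow u r r') {x y : ℕ}
    (hx : x < u) (hy : y < u) : Comparable r' x y ↔ Comparable r x y :=
  or_congr (h x hx y hy) (h y hy x hx)

theorem AgreeBelow.mem_relCode {u : ℕ} {r r' : ℕ → ℕ → Prop} (h : AgreeBelow u r r') :
    ∀ k < u, (k ∈ relCode r' ↔ k ∈ relCode r) := by
  intro k hk
  have h2 : k / 2 < u := lt_of_le_of_lt (Nat.div_le_self _ _) hk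
  exact or_congr Iff.rfl (h _ ((Nat.unpair_left_le _).trans_lt h2) _
    ((Nat.unpair_right_le _).trans_lt h2))

theorem mem_setJoin_congr {A A' B B' : Set ℕ} {u : ℕ} (hA : ∀ k < u, (k ∈ A' ↔ k ∈ A))
    (hB : ∀ k < u, (k ∈ B' ↔ k ∈ B)) : ∀ k < u, (k ∈ setJoin A' B' ↔ k ∈ setJoin A B) := by
  intro k hk
  refine or_congr ?_ ?_
  · exact exists_congr fun n => and_congr_left fun hn => hA n (by dsimp only at hn; omega)
  · exact exists_congr fun n => and_congr_left fun hn => hB n (by dsimp only at hn; omega)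

/-! ### Continuous reductions -/

/-- The part of a Weihrauch reduction of `SCAC` to `ω`-`SCAC` that concerns posets on `ℕ`, with
computability weakened to continuity: `A r` is the instance assigned to `r`, and `B r Y` is the
solution obtained from `r` and a solution `Y` of `A r`. -/
structure Reduction (A : (ℕ → ℕ → Prop) → Set ℕ) (B : (ℕ → ℕ → Prop) → Set ℕ → Set ℕ) :
    Prop where
  isInstance : ∀ r, StableRel r → omegaSCAC.IsInstance (A r)
  use : ∀ r, StableRel r → ∀ k, ∀ᶠ u in atTop, ∀ r', StableRel r' → AgreeBelow u r r' →
    (k ∈ A r' ↔ k ∈ A r)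
  solution : ∀ r, StableRel r → ∀ Y, omegaSCAC.IsSolution (A r) Y →
    (B r Y).Infinite ∧ ∃ c : Prop, (B r Y).Pairwise fun x y => Comparable r x y ↔ c
  use_solution : ∀ r Y x, x ∈ B r Y → ∀ᶠ u in atTop, ∀ r' Y', AgreeBelow u r r' →
    (∀ k < u, (k ∈ Y' ↔ k ∈ Y)) → x ∈ B r' Y'

/-- A Weihrauch reduction restricts to a continuous one on the stable orders of `ℕ`. -/
theorem WeihrauchReducible.exists_reduction (h : WeihrauchReducible SCAC omegaSCAC) :
    ∃ A B, Reduction A B := by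
  obtain ⟨Φ, Ψ, h⟩ := h
  have hA : ∀ r, StableRel r →
      Φ.Defines (relCode r) (Φ.output (relCode r)) ∧
      omegaSCAC.IsInstance (Φ.output (relCode r)) ∧
      ∀ Y, omegaSCAC.IsSolution (Φ.output (relCode r)) Y →
        ∃ W, Ψ.Defines (setJoin (relCode r) Y) W ∧ SCAC.IsSolution (relCode r) W := by
    intro r hr
    obtain ⟨Z, hZ, h1, h2⟩ := h _ hr.isInstance
    rw [← hZ.eq_output]
    exact ⟨hZ, h1, h2⟩
  refine ⟨fun r => Φ.output (relCode r),
    fun r Y => Ψ.output (setJoin (relCode r) Y),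
    ⟨fun r hr => (hA r hr).2.1, fun r hr k => ?_, fun r hr Y hY => ?_, fun r Y x hx => ?_⟩⟩
  · have hk := (hA r hr).1 k
    filter_upwards [Φ.eventually_mem_eval _ _ _ (Part.eq_some_iff.1 hk)] with u hu r' hr' hrr'
    have h1 := hu _ hrr'.mem_relCode
    rw [(hA r' hr').1 k, Part.mem_some_iff] at h1
    rw [← charFun_eq_one, ← charFun_eq_one, h1]
  · obtain ⟨W, hW, hWs⟩ := (hA r hr).2.2 Y hY
    rw [← hW.eq_output]
    refine ⟨hWs.1, ?_⟩
    have hWs := hWs.2.2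
    rw [codedRel_relCode] at hWs
    rcases hWs with hWs | hWs
    · exact ⟨True, fun x hx y hy hxy => iff_of_true (hWs hx hy hxy) trivial⟩
    · exact ⟨False, fun x hx y hy hxy =>
        iff_of_false (fun h => h.elim (hWs hx hy hxy) (hWs hy hx hxy.symm)) id⟩
  · filter_upwards [Ψ.eventually_mem_eval _ _ _ hx] with u hu r' Y' hr' hY'
    exact hu _ (mem_setJoin_congr hr'.mem_relCode hY')

section

variable {A : (ℕ → ℕ → Prop) → Set ℕ} {B : (ℕ → ℕ → Prop) → Set ℕ → Set ℕ}

/-- Replacing every poset by its dual gives a reduction again. -/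
theorem Reduction.swap (h : Reduction A B) :
    Reduction (fun r => A (Function.swap r)) (fun r => B (Function.swap r)) where
  isInstance r hr := h.isInstance _ hr.swap
  use r hr k := by
    filter_upwards [h.use _ hr.swap k] with u hu r' hr' hrr' using hu _ hr'.swap hrr'.swap
  solution r hr Y hY := by
    simpa only [comparable_swap] using h.solution _ hr.swap Y hY
  use_solution r Y x hx := by
    filter_upwards [h.use_solution _ Y x hx] with u hu r' Y' hr' using hu _ Y' hr'.swap

/-- Below a large enough bound, `r` determines the poset coded by `A r` on a finite set. -/
theorem Reduction.eventually_use (h : Reduction A B) {r : ℕ → ℕ → Prop} (hr : StableRel r)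
    {F : Set ℕ} (hF : F.Finite) :
    ∀ᶠ u in atTop, ∀ r', StableRel r' → AgreeBelow u r r' →
      (∀ x ∈ F, (x ∈ codedSet (A r') ↔ x ∈ codedSet (A r))) ∧
      ∀ x ∈ F, ∀ y ∈ F, (Comparable (codedRel (A r')) x y ↔ Comparable (codedRel (A r)) x y) := by
  have h1 := (eventually_all_finite hF).2 fun x _ => h.use r hr (2 * x)
  have h2 := (eventually_all_finite hF).2 fun x _ => (eventually_all_finite hF).2 fun y _ =>
    h.use r hr (2 * Nat.pair x y + 1)
  filter_upwards [h1, h2] with u h1 h2 r' hr' hrr'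
  exact ⟨fun x hx => h1 x hx r' hr' hrr', fun x hx y hy =>
    or_congr (h2 x hx y hy r' hr' hrr') (h2 y hy x hx r' hr' hrr')⟩

/-- The set `B r Y` is infinite and homogeneous, so the comparability status of any two of its
elements is the limit colour of both. -/
theorem Reduction.limitColor (h : Reduction A B) {r : ℕ → ℕ → Prop} (hr : StableRel r) {Y : Set ℕ}
    (hY : omegaSCAC.IsSolution (A r) Y) {x y : ℕ} (hx : x ∈ B r Y) (hy : y ∈ B r Y) (hxy : x ≠ y)
    {z : ℕ} (hz : z = x ∨ z = y) : LimitColor Set.univ r (Comparable r x y) z := by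
  obtain ⟨hinf, c, hc⟩ := h.solution r hr Y hY
  have hzB : z ∈ B r Y := by rcases hz with rfl | rfl <;> assumption
  rcases hr.limitColor z (Comparable r x y) with hz | hz
  · exact hz
  · obtain ⟨w, hw, hzw, hwz⟩ :=
      ((Nat.frequently_atTop_iff_infinite.2 hinf).and_eventually
        (hz.and (eventually_gt_atTop z))).exists
    have h1 := hzw trivial
    have h2 := hc hzB hw hwz.ne
    have h3 := hc hx hy hxy
    tauto

/-- A solution `Y` of `A r` yields two elements of `B r Y` above any bound `n`, and below a large
enough bound `u` the finite data that `r` and `Y` provide suffice for this. -/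
theorem Reduction.exists_pair (h : Reduction A B) {r : ℕ → ℕ → Prop} (hr : StableRel r) {Y : Set ℕ}
    (hY : omegaSCAC.IsSolution (A r) Y) (n : ℕ) :
    ∃ x y, n ≤ x ∧ n ≤ y ∧ x ≠ y ∧ ∀ᶠ u in atTop, x < u ∧ y < u ∧
      ∀ r' Y', AgreeBelow u r r' → (∀ k < u, (k ∈ Y' ↔ k ∈ Y)) → x ∈ B r' Y' ∧ y ∈ B r' Y' := by
  have hinf := (h.solution r hr Y hY).1
  obtain ⟨x, hx, hnx⟩ := hinf.exists_gt n
  obtain ⟨y, hy, hxy⟩ := hinf.exists_gt x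
  refine ⟨x, y, hnx.le, (hnx.trans hxy).le, hxy.ne, ?_⟩
  filter_upwards [h.use_solution r Y x hx, h.use_solution r Y y hy, eventually_gt_atTop y]
    with u h1 h2 hu
  exact ⟨hxy.trans hu, hu, fun r' Y' hr' hY' => ⟨h1 r' Y' hr' hY', h2 r' Y' hr' hY'⟩⟩

end

/-! ### Forcing with finite conditions -/

/-- A forcing condition: a partial order of which only the rows and columns of the numbers below
`n` count, where each of these numbers is promised to be below, or incomparable with, all numbers
from `n` on. -/
structure Cond where
  n : ℕ
  r : ℕ → ℕ → Prop
  isPartialOrder : IsPartialOrder ℕ r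
  limit : ∀ x < n, (∀ y, n ≤ y → r x y) ∨ ∀ y, n ≤ y → ¬ Comparable r x y

/-- The order `r` satisfies the condition `p`. -/
def Cond.Obeys (p : Cond) (r : ℕ → ℕ → Prop) : Prop :=
  ∀ x y, x < p.n ∨ y < p.n → (r x y ↔ p.r x y)

/-- The condition `q` is stronger than `p`. -/
def Cond.Extends (q p : Cond) : Prop :=
  p.n ≤ q.n ∧ p.Obeys q.r

theorem Cond.Extends.refl (p : Cond) : p.Extends p :=
  ⟨le_rfl, fun _ _ _ => Iff.rfl⟩

theorem Cond.Extends.obeys {p q : Cond} (h : q.Extends p) {r : ℕ → ℕ → Prop} (hr : q.Obeys r) :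
    p.Obeys r :=
  fun x y hxy => (hr x y (hxy.imp (·.trans_le h.1) (·.trans_le h.1))).trans (h.2 x y hxy)

theorem Cond.Extends.trans {p q s : Cond} (h : s.Extends q) (h' : q.Extends p) : s.Extends p :=
  ⟨h'.1.trans h.1, h'.obeys h.2⟩

theorem Cond.Obeys.agreeBelow {p : Cond} {r : ℕ → ℕ → Prop} (h : p.Obeys r) :
    AgreeBelow p.n p.r r :=
  fun x hx y _ => h x y (.inl hx)

/-- The condition that keeps `r` below `u` and promises that, among the numbers below `u`, the
elements of `S` are small and the others isolated. -/
def Cond.ofSet (r : ℕ → ℕ → Prop) (hr : IsPartialOrder ℕ r) (u : ℕ) (S : Set ℕ)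
    (hS : ∀ x < u, ∀ y < u, r x y → y ∈ S → x ∈ S) : Cond where
  n := u
  r x y := if y < u then x < u ∧ r x y else if x < u then x ∈ S else x = y
  isPartialOrder :=
    { refl := fun x => by by_cases hx : x < u <;> simp [hx, hr.refl x]
      antisymm := fun x y hxy hyx => by
        by_cases hx : x < u <;> by_cases hy : y < u <;> simp [hx, hy] at hxy hyx
        · exact hr.antisymm x y hxy hyx
        · exact hxy
      trans := fun x y z hxy hyz => by
        by_cases hx : x < u <;> by_cases hy : y < u <;> by_cases hz : z < u <;>
          simp [hx, hy, hz] at hxy hyz ⊢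
        · exact hr.trans x y z hxy hyz
        · exact hS x hx y hy hxy hyz
        · exact hxy
        · exact hxy.trans hyz }
  limit x hx := by
    by_cases hxS : x ∈ S
    · refine .inl fun y hy => ?_
      simp [hx, hy.not_gt, hxS]
    · refine .inr fun y hy => ?_
      simp [Comparable, hx, hy.not_gt, hxS]

theorem Cond.agreeBelow_ofSet {r : ℕ → ℕ → Prop} {hr : IsPartialOrder ℕ r} {u : ℕ} {S : Set ℕ}
    {hS : ∀ x < u, ∀ y < u, r x y → y ∈ S → x ∈ S} : AgreeBelow u r (Cond.ofSet r hr u S hS).r :=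
  fun x hx y hy => by simp [Cond.ofSet, hx, hy]

theorem Cond.limitColor_ofSet {r : ℕ → ℕ → Prop} {hr : IsPartialOrder ℕ r} {u : ℕ} {S : Set ℕ}
    {hS : ∀ x < u, ∀ y < u, r x y → y ∈ S → x ∈ S} {r' : ℕ → ℕ → Prop}
    (h : (Cond.ofSet r hr u S hS).Obeys r') {x : ℕ} (hx : x < u) :
    LimitColor Set.univ r' (x ∈ S) x := by
  filter_upwards [eventually_ge_atTop u] with y hy _
  have hxu : x < (Cond.ofSet r hr u S hS).n := hx
  rw [Comparable, h x y (.inl hxu), h y x (.inr hxu)]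
  simp [Cond.ofSet, hx, hy.not_gt]

/-- A condition can be extended so as to agree with a given compatible order up to a bound `u`,
with all numbers between the old and the new bound being promised the same limit colour `c`. -/
theorem Cond.exists_extends (p : Cond) {r : ℕ → ℕ → Prop} (hr : IsPartialOrder ℕ r)
    (hpr : p.Obeys r) {u : ℕ} (hu : p.n ≤ u) (c : Prop) :
    ∃ q : Cond, q.Extends p ∧ q.n = u ∧ AgreeBelow u r q.r ∧
      ∀ r', q.Obeys r' → ∀ x, p.n ≤ x → x < u → LimitColor Set.univ r' c x := by
  have hlim : ∀ x < p.n, (∀ y, p.n ≤ y → r x y) ∨ ∀ y, p.n ≤ y → ¬ Comparable r x y := by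
    intro x hx
    refine (p.limit x hx).imp (fun h y hy => (hpr x y (.inl hx)).2 (h y hy)) fun h y hy => ?_
    rw [Comparable, hpr x y (.inl hx), hpr y x (.inr hx)]
    exact h y hy
  -- The small elements: those that `p` promises to be small, and all the new ones if `c` holds.
  let S : Set ℕ := {x | if x < p.n then ∀ y, p.n ≤ y → r x y else c}
  have hS : ∀ x < u, ∀ y < u, r x y → y ∈ S → x ∈ S := by
    intro x hxu y hyu hxy hy
    by_cases hxn : x < p.n <;> by_cases hyn : y < p.n <;>
      simp only [S, Set.mem_ofPred_eq, hxn, hyn, if_true, if_false] at hy ⊢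
    · exact fun z hz => hr.trans _ _ _ hxy (hy z hz)
    · rcases hlim x hxn with h | h
      · exact h
      · exact absurd (.inl hxy) (h y (not_lt.1 hyn))
    · have : x = y := hr.antisymm _ _ hxy (hy x (not_lt.1 hxn))
      omega
    · exact hy
  refine ⟨Cond.ofSet r hr u S hS, ⟨hu, ?_⟩, rfl, Cond.agreeBelow_ofSet, fun r' hr' x hx hxu => ?_⟩
  · intro x y hxy
    rw [← hpr x y hxy]
    by_cases hxu : x < u <;> by_cases hyu : y < u
    · simp [Cond.ofSet, hxu, hyu]
    · have hxn : x < p.n := by omega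
      have hny : p.n ≤ y := by omega
      have : r x y ↔ ∀ y, p.n ≤ y → r x y :=
        ⟨fun h => (hlim x hxn).resolve_right fun h' => h' y hny (.inl h), fun h => h y hny⟩
      simp only [Cond.ofSet, hxu, hyu, if_true, if_false, this]
      simp [S, hxn]
    · have hyn : y < p.n := by omega
      have hnx : p.n ≤ x := by omega
      simp only [Cond.ofSet, hxu, hyu, if_true, false_and, false_iff]
      intro h
      rcases hlim y hyn with h' | h'
      · have := hr.antisymm _ _ h (h' x hnx)
        omega
      · exact h' x hnx (.inr h)
    · omega
  · have := Cond.limitColor_ofSet hr' hxu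
    simpa [S, hx.not_gt] using this

/-- Every condition is satisfied by an order that meets countably many given dense sets. -/
theorem Cond.exists_generic (p : Cond) {ι : Type*} [Countable ι] [Nonempty ι] (D : ι → Set Cond)
    (hD : ∀ i, ∀ q : Cond, q.Extends p → ∃ q' : Cond, q'.Extends q ∧ q' ∈ D i) :
    ∃ r, SmallStable r ∧ p.Obeys r ∧ ∀ i, ∃ q ∈ D i, q.Obeys r := by
  obtain ⟨e, he⟩ := exists_surjective_nat ι
  have step : ∀ (k : ℕ) (q : Cond), q.Extends p →
      ∃ q' : Cond, q'.Extends q ∧ q' ∈ D (e k) ∧ k < q'.n := by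
    intro k q hq
    obtain ⟨q₁, hq₁, hn, -⟩ := q.exists_extends q.isPartialOrder (Cond.Extends.refl q).2
      (u := max q.n (k + 1)) (le_max_left _ _) True
    obtain ⟨q₂, hq₂, hD₂⟩ := hD (e k) q₁ (hq₁.trans hq)
    exact ⟨q₂, hq₂.trans hq₁, hD₂, lt_of_lt_of_le (lt_of_lt_of_le (by omega) hn.ge) hq₂.1⟩
  choose! f hf hfD hfn using step
  let s : ℕ → Cond := Nat.rec p f
  have hsp : ∀ k, (s k).Extends p := by
    intro k
    induction k with
    | zero => exact Cond.Extends.refl p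
    | succ k ih => exact (hf k (s k) ih).trans ih
  have hs : ∀ k, (s (k + 1)).Extends (s k) := fun k => hf k (s k) (hsp k)
  have hmono : ∀ j k, j ≤ k → (s k).Extends (s j) := by
    intro j k hjk
    induction hjk with
    | refl => exact Cond.Extends.refl _
    | step _ ih => exact (hs _).trans ih
  have hn : ∀ k, k ≤ (s k).n := by
    intro k
    cases k with
    | zero => exact Nat.zero_le _
    | succ k => exact hfn k (s k) (hsp k)
  let r : ℕ → ℕ → Prop := fun x y => (s (min x y + 1)).r x y
  have hr : ∀ k, (s k).Obeys r := by
    intro k x y hxy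
    rcases le_total k (min x y + 1) with h | h
    · exact (hmono _ _ h).2 x y hxy
    · refine ((hmono _ _ h).2 x y ?_).symm
      have := hn (min x y + 1)
      omega
  have hpo : IsPartialOrder ℕ r :=
    { refl := fun x => (hr (x + 1) x x (.inl (hn _))).2 ((s (x + 1)).isPartialOrder.refl x)
      antisymm := fun x y hxy hyx => by
        have h : x < (s (x + 1)).n := hn (x + 1)
        rw [hr (x + 1) x y (.inl h)] at hxy
        rw [hr (x + 1) y x (.inr h)] at hyx
        exact (s (x + 1)).isPartialOrder.antisymm x y hxy hyx
      trans := fun x y z hxy hyz => by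
        have h : max x y < (s (max x y + 1)).n := hn (max x y + 1)
        generalize max x y + 1 = k at h
        rw [max_lt_iff] at h
        rw [hr k x y (.inl h.1)] at hxy
        rw [hr k y z (.inl h.2)] at hyz
        exact (hr k x z (.inl h.1)).2 ((s k).isPartialOrder.trans x y z hxy hyz) }
  refine ⟨r, ⟨hpo, fun x => ?_⟩, hr 0, fun i => ?_⟩
  · have hx : x < (s (x + 1)).n := hn (x + 1)
    refine ((s (x + 1)).limit x hx).imp (fun h => ?_) fun h => ?_
    · filter_upwards [eventually_ge_atTop (s (x + 1)).n] with y hy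
      exact (hr (x + 1) x y (.inl hx)).2 (h y hy)
    · filter_upwards [eventually_ge_atTop (s (x + 1)).n] with y hy
      rw [Comparable, hr (x + 1) x y (.inl hx), hr (x + 1) y x (.inr hx)]
      exact h y hy
  · obtain ⟨k, rfl⟩ := he i
    exact ⟨s (k + 1), hfD k (s k) (hsp k), hr (k + 1)⟩

/-- A property of `r` that holds by virtue of a finite part of `r` is forced by a condition. -/
theorem Cond.exists_forces (p : Cond) {r : ℕ → ℕ → Prop} (hr : SmallStable r) (hpr : p.Obeys r)
    {φ : (ℕ → ℕ → Prop) → Prop}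
    (hφ : ∀ᶠ u in atTop, ∀ r', StableRel r' → AgreeBelow u r r' → φ r') :
    ∃ q : Cond, q.Extends p ∧ ∀ r', SmallStable r' → q.Obeys r' → φ r' := by
  obtain ⟨u, hu, hpu⟩ := (hφ.and (eventually_ge_atTop p.n)).exists
  obtain ⟨q, hqp, rfl, hrq, -⟩ := p.exists_extends hr.isPartialOrder hpr hpu True
  exact ⟨q, hqp, fun r' hr' hqr' => hu r' (.inl hr') fun x hx y hy =>
    (hqr'.agreeBelow x hx y hy).trans (hrq x hx y hy)⟩

/-- The condition `q` forces that `k` is an element of limit colour `c` in the poset coded by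
`A r`, with a fixed bound on the exceptions. -/
def Cond.ForcesLimit (A : (ℕ → ℕ → Prop) → Set ℕ) (q : Cond) (c : Prop) (k : ℕ) : Prop :=
  ∃ b, ∀ r, SmallStable r → q.Obeys r → k ∈ codedSet (A r) ∧
    ∀ y ≥ b, y ∈ codedSet (A r) → (Comparable (codedRel (A r)) k y ↔ c)

section

variable {A : (ℕ → ℕ → Prop) → Set ℕ} {B : (ℕ → ℕ → Prop) → Set ℕ → Set ℕ}

/-- Let the part below `u` of a homogeneous set `Y` of colour `c` produce the elements `x ≠ y`. If
an order `r'` with the same finite data gives `x` or `y` a limit colour that rules it out of every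
solution containing both, then this part of `Y` cannot extend to a solution of `A r'`, so some
element of it has lost the limit colour `c`. -/
theorem Reduction.exists_not_limitColor (h : Reduction A B) {r r' : ℕ → ℕ → Prop}
    (hr' : StableRel r') {c : Prop}
    (hinf : {k ∈ codedSet (A r') |
      LimitColor (codedSet (A r')) (codedRel (A r')) c k}.Infinite)
    {Y : Set ℕ} (hY : Y ⊆ codedSet (A r))
    (hYc : Y.Pairwise fun x y => Comparable (codedRel (A r)) x y ↔ c) {x y z u : ℕ}
    (hxy : x ≠ y) (hz : z = x ∨ z = y)
    (hpair : ∀ r' Y', AgreeBelow u r r' → (∀ k < u, (k ∈ Y' ↔ k ∈ Y)) →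
      x ∈ B r' Y' ∧ y ∈ B r' Y')
    (hrr' : AgreeBelow u r r') (hxyr : Comparable r' x y ↔ Comparable r x y)
    (hFA : ∀ k ∈ Y, k < u → (k ∈ codedSet (A r') ↔ k ∈ codedSet (A r)))
    (hFc : ∀ k ∈ Y, k < u → ∀ l ∈ Y, l < u →
      (Comparable (codedRel (A r')) k l ↔ Comparable (codedRel (A r)) k l))
    (hzlim : LimitColor Set.univ r' (¬ Comparable r x y) z) :
    ∃ k ∈ Y, k < u ∧ LimitColor (codedSet (A r')) (codedRel (A r')) (¬ c) k := by
  by_contra hcon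
  have hF' : {k ∈ Y | k < u} ⊆ codedSet (A r') := fun k hk => (hFA k hk.1 hk.2).2 (hY hk.1)
  obtain ⟨Y', hY', hYF, -⟩ := exists_isSolution_extending hinf
    (F := {k ∈ Y | k < u}) (u := u) (fun k hk => hk.2) hF'
    (fun a ha b hb hab => (hFc a ha.1 ha.2 b hb.1 hb.2).trans (hYc ha.1 hb.1 hab))
    (fun k hk => (limitColor_of_isInstance (h.isInstance r' hr') (hF' hk) c).resolve_right
      fun hn => hcon ⟨k, hk.1, hk.2, hn⟩)
  obtain ⟨hx', hy'⟩ := hpair r' Y' hrr' fun k hk =>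
    (hYF k hk).trans ⟨fun h => h.1, fun h => ⟨h, hk⟩⟩
  have h1 := (h.limitColor hr' hY' hx' hy' hxy hz).iff Set.infinite_univ hzlim
  rw [hxyr] at h1
  tauto

/-- If no extension of `p` forces an element from `m` on to have limit colour `c`, then all these
elements have the opposite limit colour in the poset obtained from a generic order. -/
theorem Reduction.exists_forall_limitColor_not (h : Reduction A B) {p : Cond} {c : Prop} {m : ℕ}
    (hp : ∀ q : Cond, q.Extends p → ∀ k ≥ m, ¬ q.ForcesLimit A c k) {q : Cond}
    (hq : q.Extends p) :
    ∃ r, SmallStable r ∧ q.Obeys r ∧ ∀ k ≥ m, k ∈ codedSet (A r) →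
      LimitColor (codedSet (A r)) (codedRel (A r)) (¬ c) k := by
  obtain ⟨r, hr, hqr, hD⟩ := q.exists_generic (ι := ℕ × ℕ)
    (fun i => {s : Cond | m ≤ i.1 → ∀ r, SmallStable r → s.Obeys r → i.1 ∉ codedSet (A r) ∨
      ∃ y ≥ i.2, y ∈ codedSet (A r) ∧ ¬ (Comparable (codedRel (A r)) i.1 y ↔ c)}) (by
    rintro ⟨k, b⟩ s hs
    by_cases hk : m ≤ k
    swap
    · exact ⟨s, Cond.Extends.refl s, fun h => absurd h hk⟩
    have hnot := hp s (hs.trans hq) k hk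
    simp only [Cond.ForcesLimit, not_exists, not_forall] at hnot
    obtain ⟨r, hr, hsr, hrb⟩ := hnot b
    by_cases hkA : k ∈ codedSet (A r)
    · simp only [hkA, true_and, not_forall] at hrb
      obtain ⟨y, hy, hyA, hky⟩ := hrb
      have hfin : ({k, y} : Set ℕ).Finite := by simp
      obtain ⟨s', hs', hs'A⟩ := s.exists_forces hr hsr (h.eventually_use (.inl hr) hfin)
      refine ⟨s', hs', fun _ r' hr' hsr' => .inr ⟨y, hy, ?_, ?_⟩⟩
      · exact ((hs'A r' hr' hsr').1 y (by simp)).2 hyA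
      · change ¬ (Comparable _ k y ↔ c)
        rwa [(hs'A r' hr' hsr').2 k (by simp) y (by simp)]
    · obtain ⟨s', hs', hs'A⟩ := s.exists_forces hr hsr
        (h.eventually_use (.inl hr) (Set.finite_singleton k))
      exact ⟨s', hs', fun _ r' hr' hsr' =>
        .inl fun hk' => hkA (((hs'A r' hr' hsr').1 k rfl).1 hk')⟩)
  refine ⟨r, hr, hqr, fun k hk hkA => ?_⟩
  refine (limitColor_of_isInstance (h.isInstance r (.inl hr)) hkA c).resolve_left fun hlim => ?_
  obtain ⟨b, hb⟩ := eventually_atTop.1 hlim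
  obtain ⟨s, hs, hsr⟩ := hD (k, b)
  rcases hs hk r hr hsr with hkn | ⟨y, hy, hyA, hky⟩
  · exact hkn hkA
  · exact hky (hb y hy hyA)

/-- Every condition has an extension that forces some large element to have limit colour `c`.
Otherwise all large elements have the opposite limit colour for generic orders, so that every
finite homogeneous set of that colour extends to a solution; after such a set has produced two
elements outside the condition, these can be given the wrong limit colour. -/
theorem Reduction.exists_forcesLimit (h : Reduction A B) (p : Cond) (c : Prop) (m : ℕ) :
    ∃ q : Cond, q.Extends p ∧ ∃ k ≥ m, q.ForcesLimit A c k := by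
  by_contra hcon
  have hp : ∀ q : Cond, q.Extends p → ∀ k ≥ m, ¬ q.ForcesLimit A c k :=
    fun q hq k hk hqk => hcon ⟨q, hq, k, hk, hqk⟩
  have hinf : ∀ r, StableRel r → (∀ k ≥ m, k ∈ codedSet (A r) →
      LimitColor (codedSet (A r)) (codedRel (A r)) (¬ c) k) →
      {k ∈ codedSet (A r) | LimitColor (codedSet (A r)) (codedRel (A r)) (¬ c) k}.Infinite := by
    intro r hr hlim
    refine ((h.isInstance r hr).1.infinite.sdiff (Set.finite_lt_nat m)).mono fun k hk => ?_
    exact ⟨hk.1, hlim k (not_lt.1 hk.2) hk.1⟩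
  obtain ⟨r, hr, hpr, hlim⟩ := h.exists_forall_limitColor_not hp (Cond.Extends.refl p)
  obtain ⟨Y, hY, hYm, hYc, -⟩ := exists_isSolution_extending (F := ∅) (u := m)
    (hinf r (.inl hr) hlim) (by simp) (by simp) (by simp) (by simp)
  obtain ⟨x, y, hx, hy, hxy, hpair⟩ := h.exists_pair (.inl hr) hY p.n
  obtain ⟨u, ⟨hxu, hyu, hu⟩, hpu⟩ := (hpair.and (eventually_ge_atTop p.n)).exists
  obtain ⟨v, hv, huv⟩ :=
    ((h.eventually_use (.inl hr) (Set.finite_lt_nat u)).and (eventually_ge_atTop u)).exists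
  -- Let the numbers from `p.n` to `v` have the limit colour that `x` must not have.
  obtain ⟨q, hqp, rfl, hrq, hqlim⟩ := p.exists_extends hr.isPartialOrder hpr (hpu.trans huv)
    (¬ Comparable r x y)
  obtain ⟨r', hr', hqr', hlim'⟩ := h.exists_forall_limitColor_not hp hqp
  have hrr' : AgreeBelow q.n r r' := fun a ha b hb =>
    (hqr'.agreeBelow a ha b hb).trans (hrq a ha b hb)
  obtain ⟨hA, hAc⟩ := hv r' (.inl hr') hrr'
  obtain ⟨k, hkY, hku, hk⟩ := h.exists_not_limitColor (.inl hr') (hinf r' (.inl hr') hlim')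
    hY.2.1 hYc hxy (.inl rfl) hu (hrr'.mono huv)
    (hrr'.comparable (hxu.trans_le huv) (hyu.trans_le huv)) (fun k _ hk => hA k hk)
    (fun k _ hk l _ hl => hAc k hk l hl) (hqlim r' hqr' x hx (hxu.trans_le huv))
  have hkm : m ≤ k := not_lt.1 fun hkm => by simpa using (hYm k hkm).1 hkY
  have := (hlim' k hkm ((hA k hku).2 (hY.2.1 hkY))).iff (h.isInstance r' (.inl hr')).1.infinite hk
  tauto

/-- For a generic order both limit colours occur infinitely often in the resulting poset. -/
theorem Reduction.exists_infinite_limitColor (h : Reduction A B) (p : Cond) :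
    ∃ r, SmallStable r ∧ p.Obeys r ∧ ∀ c : Prop,
      {k ∈ codedSet (A r) | LimitColor (codedSet (A r)) (codedRel (A r)) c k}.Infinite := by
  obtain ⟨r, hr, hpr, hD⟩ := p.exists_generic (ι := Prop × ℕ)
    (fun i => {q : Cond | ∃ k ≥ i.2, q.ForcesLimit A i.1 k})
    fun i q _ => h.exists_forcesLimit q i.1 i.2
  refine ⟨r, hr, hpr, fun c => Set.infinite_of_not_bddAbove ?_⟩
  rintro ⟨m, hm⟩
  obtain ⟨q, ⟨k, hk, b, hb⟩, hqr⟩ := hD (c, m + 1)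
  obtain ⟨hkA, hkb⟩ := hb r hr hqr
  have : k ≤ m := hm ⟨hkA, by filter_upwards [eventually_ge_atTop b] with y hy using hkb y hy⟩
  have hk : m + 1 ≤ k := hk
  omega

end

/-! ### Using a poset whose type is undecided -/

/-- Two pairs of distinct elements can be spoiled at the same time, if one may choose between the
given order and its dual: some down-closed set `S`, intended as the set of small elements,
disagrees on an element of each pair with the comparability status of that pair. -/
theorem exists_spoiling_set {r : ℕ → ℕ → Prop} (hr : IsPartialOrder ℕ r) {x y a b : ℕ}
    (hxy : x ≠ y) (hab : a ≠ b) :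
    ∃ r', (r' = r ∨ r' = Function.swap r) ∧ ∃ S : Set ℕ, (∀ v w, r' v w → w ∈ S → v ∈ S) ∧
      (∃ z, (z = x ∨ z = y) ∧ (z ∈ S ↔ ¬ Comparable r x y)) ∧
      ∃ w, (w = a ∨ w = b) ∧ (w ∈ S ↔ ¬ Comparable r a b) := by
  -- If `v < w` and `s` is given, then the down-closure of `s` in `r` or in its dual misses one
  -- of `v` and `w`.
  have key : ∀ v w s, v ≠ w → r v w → ∃ r', (r' = r ∨ r' = Function.swap r) ∧ ∃ S : Set ℕ,
      (∀ v w, r' v w → w ∈ S → v ∈ S) ∧ s ∈ S ∧ ∃ z, (z = v ∨ z = w) ∧ z ∉ S := by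
    intro v w s hvw hrvw
    by_cases hws : r w s
    · refine ⟨Function.swap r, .inr rfl, {t | r s t}, fun v w hvw hw => hr.trans _ _ _ hw hvw,
        hr.refl s, v, .inl rfl, fun hsv => hvw ?_⟩
      exact hr.antisymm _ _ hrvw (hr.trans _ _ _ hws hsv)
    · exact ⟨r, .inl rfl, {t | r t s}, fun v w hvw hw => hr.trans _ _ _ hvw hw, hr.refl s, w,
        .inr rfl, hws⟩
  have key' : ∀ v w s, v ≠ w → Comparable r v w → ∃ r', (r' = r ∨ r' = Function.swap r) ∧
      ∃ S : Set ℕ, (∀ v w, r' v w → w ∈ S → v ∈ S) ∧ s ∈ S ∧ ∃ z, (z = v ∨ z = w) ∧ z ∉ S := by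
    rintro v w s hvw (h | h)
    · exact key v w s hvw h
    · simpa only [or_comm] using key w v s hvw.symm h
  by_cases h1 : Comparable r x y <;> by_cases h2 : Comparable r a b
  · exact ⟨r, .inl rfl, ∅, by simp, ⟨x, by simp [h1]⟩, ⟨a, by simp [h2]⟩⟩
  · obtain ⟨r', hr', S, hS, haS, z, hz, hzS⟩ := key' x y a hxy h1
    exact ⟨r', hr', S, hS, ⟨z, hz, by simp [h1, hzS]⟩, ⟨a, .inl rfl, by simp [h2, haS]⟩⟩
  · obtain ⟨r', hr', S, hS, hxS, z, hz, hzS⟩ := key' a b x hab h2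
    exact ⟨r', hr', S, hS, ⟨x, .inl rfl, by simp [h1, hxS]⟩, ⟨z, hz, by simp [h2, hzS]⟩⟩
  · exact ⟨r, .inl rfl, Set.univ, by simp, ⟨x, by simp [h1]⟩, ⟨a, by simp [h2]⟩⟩

/-- The weakest condition: it is satisfied by every order. -/
def Cond.trivial : Cond where
  n := 0
  r := Eq
  isPartialOrder := { refl := Eq.refl, antisymm := fun _ _ h _ => h, trans := fun _ _ _ => Eq.trans }
  limit x hx := absurd hx (Nat.not_lt_zero x)

/-- Below a bound `u` an order does not show whether its unpromised elements will become small or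
large: any two pairs of elements below `u` can be spoiled in an order that agrees with the given
one below `u` and for which both limit colours occur infinitely often in the resulting poset. -/
theorem Reduction.exists_spoiling {A B} (h : Reduction A B) {r : ℕ → ℕ → Prop}
    (hr : IsPartialOrder ℕ r) {x y a b u : ℕ} (hxy : x ≠ y) (hab : a ≠ b)
    (hxu : x < u) (hyu : y < u) (hau : a < u) (hbu : b < u) :
    ∃ r', StableRel r' ∧ AgreeBelow u r r' ∧
      (∀ c : Prop,
        {k ∈ codedSet (A r') | LimitColor (codedSet (A r')) (codedRel (A r')) c k}.Infinite) ∧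
      (∃ z, (z = x ∨ z = y) ∧ LimitColor Set.univ r' (¬ Comparable r x y) z) ∧
      ∃ w, (w = a ∨ w = b) ∧ LimitColor Set.univ r' (¬ Comparable r a b) w := by
  obtain ⟨r₁, hr₁, S, hS, ⟨z, hz, hzS⟩, w, hw, hwS⟩ := exists_spoiling_set hr hxy hab
  have hr₁' : IsPartialOrder ℕ r₁ := by
    rcases hr₁ with rfl | rfl
    · exact hr
    · infer_instance
  let p := Cond.ofSet r₁ hr₁' u S fun x _ y _ => hS x y
  have hzu : z < u := by rcases hz with rfl | rfl <;> assumption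
  have hwu : w < u := by rcases hw with rfl | rfl <;> assumption
  have hp : ∀ r', p.Obeys r' → AgreeBelow u r₁ r' ∧
      LimitColor Set.univ r' (¬ Comparable r x y) z ∧
      LimitColor Set.univ r' (¬ Comparable r a b) w := by
    intro r' hr'
    refine ⟨fun v hv w hw => (hr'.agreeBelow v hv w hw).trans (Cond.agreeBelow_ofSet v hv w hw), ?_⟩
    rw [← propext hzS, ← propext hwS]
    exact ⟨Cond.limitColor_ofSet hr' hzu, Cond.limitColor_ofSet hr' hwu⟩
  rcases hr₁ with rfl | rfl
  · obtain ⟨r', hr', hpr', hinf⟩ := h.exists_infinite_limitColor p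
    obtain ⟨h1, h2, h3⟩ := hp r' hpr'
    exact ⟨r', .inl hr', h1, hinf, ⟨z, hz, h2⟩, w, hw, h3⟩
  · obtain ⟨r', hr', hpr', hinf⟩ := h.swap.exists_infinite_limitColor p
    obtain ⟨h1, h2, h3⟩ := hp r' hpr'
    exact ⟨Function.swap r', .inr hr', h1.swap, hinf, ⟨z, hz, limitColor_swap.2 h2⟩, w, hw,
      limitColor_swap.2 h3⟩

/-- Not even a continuous reduction exists. A chain of the resulting poset whose elements below `u`
produce `x` and `y`, and an antichain above them whose elements below `w` produce `a` and `b`,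
cannot both be answered correctly once the two pairs are spoiled. -/
theorem not_reduction (A B) : ¬ Reduction A B := by
  intro h
  obtain ⟨r, hr, -, hinf⟩ := h.exists_infinite_limitColor Cond.trivial
  obtain ⟨Y, hY, -, hYc, hYlim⟩ := exists_isSolution_extending (F := ∅) (u := 0)
    (hinf True) (by simp) (by simp) (by simp) (by simp)
  obtain ⟨x, y, -, -, hxy, hpair⟩ := h.exists_pair (.inl hr) hY 0
  obtain ⟨u, hxu, hyu, hu⟩ := hpair.exists
  have hlim : ∀ᶠ v in atTop, ∀ k ∈ {k ∈ Y | k < u}, v ∈ codedSet (A r) →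
      (Comparable (codedRel (A r)) k v ↔ True) :=
    (eventually_all_finite ((Set.finite_lt_nat u).subset fun k hk => hk.2)).2
      fun k hk => hYlim k hk.1
  obtain ⟨v, hv⟩ := eventually_atTop.1 hlim
  -- All elements of the antichain `X` lie above all elements of `Y` below `u`.
  obtain ⟨X, hX, hXv, hXc, -⟩ := exists_isSolution_extending (F := ∅) (u := max u v)
    (hinf False) (by simp) (by simp) (by simp) (by simp)
  have hXge : ∀ k ∈ X, max u v ≤ k := fun k hk =>
    not_lt.1 fun hkm => by simpa using (hXv k hkm).1 hk
  obtain ⟨a, b, -, -, hab, hpair'⟩ := h.exists_pair (.inl hr) hX 0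
  obtain ⟨w, haw, hbw, hw⟩ := hpair'.exists
  obtain ⟨s, hs, hus, hws⟩ := ((h.eventually_use (.inl hr) ((Set.finite_lt_nat (max u w)))).and
    ((eventually_ge_atTop u).and (eventually_ge_atTop w))).exists
  obtain ⟨r', hr', hrr', hinf', ⟨z, hz, hzlim⟩, t, ht, htlim⟩ := h.exists_spoiling
    hr.isPartialOrder hxy hab (hxu.trans_le hus) (hyu.trans_le hus) (haw.trans_le hws)
    (hbw.trans_le hws)
  obtain ⟨hsA, hsc⟩ := hs r' hr' hrr'
  obtain ⟨k, hkY, hku, hk⟩ := h.exists_not_limitColor hr' (hinf' True) hY.2.1 hYc hxy hz hu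
    (hrr'.mono hus) (hrr'.comparable (hxu.trans_le hus) (hyu.trans_le hus))
    (fun k _ hk => hsA k (lt_max_of_lt_left hk))
    (fun k _ hk l _ hl => hsc k (lt_max_of_lt_left hk) l (lt_max_of_lt_left hl)) hzlim
  obtain ⟨l, hlX, hlw, hl⟩ := h.exists_not_limitColor hr' (hinf' False) hX.2.1 hXc hab ht hw
    (hrr'.mono hws) (hrr'.comparable (haw.trans_le hws) (hbw.trans_le hws))
    (fun k _ hk => hsA k (lt_max_of_lt_right hk))
    (fun k _ hk l _ hl => hsc k (lt_max_of_lt_right hk) l (lt_max_of_lt_right hl)) htlim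
  have hge := hXge l hlX
  have hkl : Comparable (codedRel (A r')) k l :=
    (hsc k (lt_max_of_lt_left hku) l (lt_max_of_lt_right hlw)).2
      ((hv l ((le_max_right _ _).trans hge) k ⟨hkY, hku⟩ (hX.2.1 hlX)).2 True.intro)
  have hk' := limitColor_true_of_comparable (h.isInstance r' hr')
    (hku.trans_le ((le_max_left _ _).trans hge)) hkl (by simpa using hl)
  simpa using hk.iff (h.isInstance r' hr').1.infinite hk'

theorem mainTheorem2 : ¬ WeihrauchReducible SCAC omegaSCAC := by
  intro h
  obtain ⟨A, B, hAB⟩ := h.exists_reduction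
  exact not_reduction A B hAB
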